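/- Let $N,K\ge 1$, let $f_1,\dots,f_N:\mathbb R^K\to\mathbb R$ be continuously differentiable and $f=\frac1N\sum_i f_i$. Assume that $f(u)>\underline f$ for all $u\in\mathbb R^K$, and that for every compact $S\subset\mathbb R^K$ each $\nabla f_i$ is Lipschitz on $S$ with a constant $L_i(S)\ge 1$, where $L_i(S_1)\le L_i(S_2)$ if $S_1\subseteq S_2$. Let $W\in\mathbb R^{N\times N}$ be a mixing matrix of an undirected graph on $\{1,\dots,N\}$: $W$ is symmetric, $\mathrm{Null}(I-W)=\mathrm{span}\{\mathbf 1\}$, $-I\preceq W\preceq I$, $W_{ii}\ge0$, and for $i\ne j$, $W_{ij}>0$ if $\{i,j\}$ is an edge and $W_{ij}=0$ otherwise. Let $\eta$ be the largest absolute value of an eigenvalue of $W$ other than $1$ ($\eta=0$ if $N=1$), and assume $\eta<1$ and $\|W-\frac1N\mathbf 1\mathbf 1^T\|<1$ (spectral norm). Let $\gamma,\xi>0$ with $(1+\gamma)\eta^2<1$, $(1+\xi)\eta^2<1$, and let $0<\varepsilon<2(1-(1+\gamma)\eta^2)$. MAGENTA: given $x(0)=(x_1(0),\dots,x_N(0))\in(\mathbb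 R^K)^N$ and radii $v^0<v^1<v^2<\cdots$, let $z=\bar x(0)=\frac1N\sum_i x_i(0)$ (a bar always denotes the average over the agents), let $X(t)$ be the closed ball of radius $v^t$ centred at $z$, and assume $x_i(0)\in X(0)$ for all $i$. Put $y_i(0)=\nabla f_i(x_i(0))$, $\hat L(t)=\max_i L_i(X(t))$ and $$\alpha(t)=\min\Big\{\tfrac{1}{8N}\Big(\tfrac{\hat L(t)}{2N}+\tfrac1\gamma+\tfrac54\Big)^{-1},\ \tfrac{N(1-(1+\gamma)\eta^2)(1-(1+\xi)\eta^2)}{64(1+1/\xi)\hat L(t)^2},\ 1\Big\}.$$ Stage $t=0,1,2,\dots$ starts from $x^0_i(t)=x_i(t)$, $y_i^0(t)=y_i(t)$, performs for $r=0,\dots,R(t)-1$ and all $i$ the updates (stage index suppressed) $$\tilde x_i^{r+1}=\arg\min_{u\in X(t)}\ \langle y_i^r,u-x_i^r\rangle+\tfrac1{2\alpha(t)}\|u-x_i^r\|^2,$$ $$x_i^{r+1}=\sum_j W_{ij}\big(x_j^r+\tfrac12(\tilde x_j^{r+1}-x_j^r)\big),\qquad y_i^{r+1}=\sum_j W_{ij}y_j^r+\nabla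 f_i(x_i^{r+1})-\nabla f_i(x_i^r),$$ and outputs $x(t+1)=x^{R(t)}(t)$, $y(t+1)=y^{R(t)}(t)$. Let $R(t)=\lceil 1/(\varepsilon\alpha(t))\rceil$ for $t\ge1$; the length $R(0)\ge0$ of the preliminary stage $0$ is arbitrary ($R(0)=0$ means that the method starts with stage $1$ from $x(0),y(0)$). Let $$P(w^0;1)=f(\bar x(1))+\sum_i\|x_i(1)-\bar x(1)\|^2+\frac{1-(1+\gamma)\eta^2}{32(1+1/\xi)\hat L(1)^2}\sum_i\|y_i(1)-\bar y(1)\|^2$$ be the potential at the start of stage $1$. Suppose that the positive integer $T^*$ satisfies $$T^*=\left\lceil\frac1\varepsilon\cdot\frac{128\,(P(w^0;1)-\underline f)}{\frac1{T^*}\sum_{t=1}^{T^*}(v^t-v^{t-1})^2}\right\rceil .$$ Then there is a stage $t\in\{1,\dots,T^*\}$ in which all $x_i^r(t)$, $0\le r\le R(t)$, and all $\tilde x_i^r(t)$, $1\le r\le R(t)$, $1\le i\le N$, lie in $X(t)$ at positive distance from the boundary of $X(t)$. Moreover, in that stage the constrained updates coincide with the unconstrained ones: for all $i$ and $0\le r<R(t)$,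 $\tilde x_i^{r+1}(t)$ minimizes $\langle y_i^r,u-x_i^r\rangle+\frac1{2\alpha(t)}\|u-x_i^r\|^2$ over all $u\in\mathbb R^K$, i.e. $\tilde x_i^{r+1}(t)=x_i^r(t)-\alpha(t)\,y_i^r(t)$. -/

import Mathlib

open scoped Gradient

namespace Magenta

/-- The space `ℝ^K` with the Euclidean norm. -/
abbrev Vec (K : ℕ) : Type := EuclideanSpace ℝ (Fin K)

/-- The average `(1/N) ∑ i, x i` of the blocks of a stacked vector. -/
noncomputable def avg {N K : ℕ} (x : Fin N → Vec K) : Vec K :=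
  (1 / (N : ℝ)) • ∑ i, x i

/-- The average function `f(u) = (1/N) ∑ i, f_i(u)`. -/
noncomputable def avgFun {N K : ℕ} (f : Fin N → Vec K → ℝ) (u : Vec K) : ℝ :=
  (1 / (N : ℝ)) * ∑ i, f i u

/-- `‖x - 1 x̄‖²`, the squared Euclidean norm in `ℝ^{NK}` of the consensus error. -/
noncomputable def consensusError {N K : ℕ} (x : Fin N → Vec K) : ℝ :=
  ∑ i, ‖x i - avg x‖ ^ 2

/-- Assumptions on the problem: the local functions are continuously differentiable on `ℝ^K`, on
every compact set `S` the gradient of `f_i` is Lipschitz with constant `Lip i S ≥ 1`, these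
constants are monotone in the compact set, and the average function is bounded below by `fmin`. -/
structure ProblemAssumption {N K : ℕ} (f : Fin N → Vec K → ℝ)
    (Lip : Fin N → Set (Vec K) → ℝ) (fmin : ℝ) : Prop where
  contDiff : ∀ i, ContDiff ℝ 1 (f i)
  lipschitz : ∀ i, ∀ S : Set (Vec K), IsCompact S →
    ∀ a ∈ S, ∀ b ∈ S, ‖∇ (f i) a - ∇ (f i) b‖ ≤ Lip i S * ‖a - b‖
  mono : ∀ i, ∀ S₁ S₂ : Set (Vec K), IsCompact S₁ → IsCompact S₂ → S₁ ⊆ S₂ →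
    Lip i S₁ ≤ Lip i S₂
  one_le : ∀ i, ∀ S : Set (Vec K), IsCompact S → 1 ≤ Lip i S
  lower : ∀ u, fmin < avgFun f u

/-- The second largest modulus of an eigenvalue of `W`. (For a mixing matrix, `1` is a simple
eigenvalue and the largest one; for a single agent there is no other eigenvalue and the value
is `0`.) -/
noncomputable def secondEigenvalue {N : ℕ} (W : Matrix (Fin N) (Fin N) ℝ) : ℝ :=
  sSup {s : ℝ | ∃ μ : ℝ, μ ≠ 1 ∧ Module.End.HasEigenvalue (Matrix.toLin' W) μ ∧ s = |μ|}

/-- Assumptions on the mixing matrix `W` of the communication graph `G`. -/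
structure IsMixingMatrix {N : ℕ} (G : SimpleGraph (Fin N)) (W : Matrix (Fin N) (Fin N) ℝ) :
    Prop where
  symm : W.IsSymm
  /-- The null space of `I - W` is the span of the all-one vector. -/
  null : ∀ u : Fin N → ℝ, (1 - W).mulVec u = 0 ↔ ∃ c : ℝ, u = fun _ => c
  le_one : (1 - W).PosSemidef
  neg_one_le : (1 + W).PosSemidef
  pos_of_adj : ∀ i j, G.Adj i j → 0 < W i j
  zero_of_not_adj : ∀ i j, i ≠ j → ¬ G.Adj i j → W i j = 0
  diag_nonneg : ∀ i, 0 ≤ W i i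
  second_lt_one : secondEigenvalue W < 1
  /-- The spectral norm of `W - (1/N) 1 1ᵀ` is less than one. -/
  norm_lt_one :
    ‖Matrix.toEuclideanCLM (𝕜 := ℝ)
      (W - Matrix.of fun _ _ => 1 / (N : ℝ) : Matrix (Fin N) (Fin N) ℝ)‖ < 1

/-- The feasible set `X(t)`: the closed ball of radius `v t` centred at `z`. -/
def feasible {K : ℕ} (v : ℕ → ℝ) (z : Vec K) (t : ℕ) : Set (Vec K) :=
  Metric.closedBall z (v t)

/-- `max_i L_i(S)`. -/
noncomputable def maxLip {N K : ℕ} (Lip : Fin N → Set (Vec K) → ℝ) (S : Set (Vec K)) : ℝ :=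
  ⨆ i, Lip i S

/-- The stepsize, as a function of `Lh = max_i L_i(X(t))`. -/
noncomputable def stepSize (N : ℕ) (γ ξ η Lh : ℝ) : ℝ :=
  min (min
    (1 / (8 * (N : ℝ)) * (1 / (Lh / (2 * (N : ℝ)) + (1 / γ + 5 / 4))))
    ((N : ℝ) * (1 - (1 + γ) * η ^ 2) * (1 - (1 + ξ) * η ^ 2) /
      (64 * (1 + 1 / ξ) * Lh ^ 2)))
    1

/-- The potential function
`f(x̄) + ‖x - 1 x̄‖² + (1 - (1+γ)η²) / (32 (1 + 1/ξ) Lh²) ‖y - 1 ȳ‖²`. -/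
noncomputable def potential {N K : ℕ} (f : Fin N → Vec K → ℝ) (γ ξ η Lh : ℝ)
    (x y : Fin N → Vec K) : ℝ :=
  avgFun f (avg x) + consensusError x +
    (1 - (1 + γ) * η ^ 2) / (32 * (1 + 1 / ξ) * Lh ^ 2) * consensusError y

/-- The objective of the local subproblem: `u ↦ ⟨y, u - x⟩ + ‖u - x‖² / (2α)`. -/
noncomputable def localModel {K : ℕ} (α : ℝ) (y x u : Vec K) : ℝ :=
  inner ℝ y (u - x) + 1 / (2 * α) * ‖u - x‖ ^ 2

/-- `x`, `xt`, `y` (indexed by the stage, the inner iteration and the agent) are the iterates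
`x_i^r(t)`, `x̃_i^r(t)`, `y_i^r(t)` of the stages `0, …, T` of MAGENTA, started at `x0`, with
feasible sets `X t`, stepsizes `α t` and `β`, and `R t` inner iterations in stage `t`. -/
structure IsRun {N K : ℕ} (f : Fin N → Vec K → ℝ) (W : Matrix (Fin N) (Fin N) ℝ)
    (X : ℕ → Set (Vec K)) (α : ℕ → ℝ) (β : ℝ) (R : ℕ → ℕ) (x0 : Fin N → Vec K) (T : ℕ)
    (x xt y : ℕ → ℕ → Fin N → Vec K) : Prop where
  init_x : ∀ i, x 0 0 i = x0 i
  init_y : ∀ i, y 0 0 i = ∇ (f i) (x0 i)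
  /-- `x̃_i^{r+1}` minimizes the local model over `X(t)`. -/
  step_mem : ∀ t ≤ T, ∀ r < R t, ∀ i, xt t (r + 1) i ∈ X t
  step_min : ∀ t ≤ T, ∀ r < R t, ∀ i,
    IsMinOn (localModel (α t) (y t r i) (x t r i)) (X t) (xt t (r + 1) i)
  step_x : ∀ t ≤ T, ∀ r < R t, ∀ i,
    x t (r + 1) i = ∑ j, W i j • (x t r j + β • (xt t (r + 1) j - x t r j))
  step_y : ∀ t ≤ T, ∀ r < R t, ∀ i,
    y t (r + 1) i = ∑ j, W i j • y t r j + ∇ (f i) (x t (r + 1) i) - ∇ (f i) (x t r i)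
  /-- The next stage starts from the output of the current one. -/
  next_x : ∀ t < T, ∀ i, x (t + 1) 0 i = x t (R t) i
  next_y : ∀ t < T, ∀ i, y (t + 1) 0 i = y t (R t) i

/-- The point `u` of `S` does not touch the boundary of `S`: it has positive distance from it. -/
def AwayFromBoundary {K : ℕ} (S : Set (Vec K)) (u : Vec K) : Prop :=
  u ∈ S ∧ 0 < Metric.infDist u (frontier S)

end Magenta

/-!
Mixing preserves averages, so the average of the trackers `y` is the average of the gradients, and
an inner iteration is an inexact projected gradient step for the average function. For a stepsize in
the allowed range it lowers the potential by at least a multiple of the squared steps plus a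
multiple of the consensus error; enlarging the feasible set between two stages only lowers the
potential further. All stages together lower it by less than `P - fmin`, so some stage `t` lowers it
by less than `(ε / 128) (v t - v (t - 1)) ^ 2`. In this stage the distance of an iterate to the
average, its step, and (by Cauchy-Schwarz over at most `1 / (ε α)` iterations) the drift of the
average are each below a third of `v t - v (t - 1)`, so the stage remains in the open ball. A
constrained minimizer of a convex function in the interior is a global one.
-/

namespace Magenta

lemma norm_sub_zero_sq_le_mul_sum {E : Type*} [SeminormedAddCommGroup E] (a : ℕ → E)
    (r : ℕ) :
    ‖a r - a 0‖ ^ 2 ≤ r * ∑ s ∈ Finset.range r, ‖a (s + 1) - a s‖ ^ 2 := by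
  have path : ‖a r - a 0‖ ≤ ∑ s ∈ Finset.range r, ‖a (s + 1) - a s‖ := by
    simpa only [dist_eq_norm, norm_sub_rev] using dist_le_range_sum_dist a r
  calc ‖a r - a 0‖ ^ 2 ≤ (∑ s ∈ Finset.range r, ‖a (s + 1) - a s‖) ^ 2 := by gcongr
    _ ≤ r * ∑ s ∈ Finset.range r, ‖a (s + 1) - a s‖ ^ 2 := by
      simpa only [Finset.card_range] using sq_sum_le_card_mul_sum_sq (s := Finset.range r)

section InnerProductSpace

variable {E : Type*} [NormedAddCommGroup E] [InnerProductSpace ℝ E]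

lemma convexOn_norm_sq : ConvexOn ℝ Set.univ fun u : E => ‖u‖ ^ 2 :=
  (convexOn_norm convex_univ).pow (fun _ _ => norm_nonneg _) 2

lemma two_mul_inner_le {a : ℝ} (ha : 0 < a) (u w : E) :
    2 * inner ℝ u w ≤ a * ‖u‖ ^ 2 + 1 / a * ‖w‖ ^ 2 := by
  have cauchy_schwarz := real_inner_le_norm u w
  have young := two_mul_le_add_mul_sq (a := ‖u‖) (b := ‖w‖) ha
  rw [← one_div] at young
  linarith

lemma norm_add_sq_le {a : ℝ} (ha : 0 < a) (u w : E) :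
    ‖u + w‖ ^ 2 ≤ (1 + a) * ‖u‖ ^ 2 + (1 + 1 / a) * ‖w‖ ^ 2 := by
  rw [norm_add_sq_real]
  linarith [two_mul_inner_le ha u w]

lemma sum_norm_add_sq_le {ι : Type*} (s : Finset ι) {a : ℝ} (ha : 0 < a) (u w : ι → E) :
    ∑ i ∈ s, ‖u i + w i‖ ^ 2 ≤
      (1 + a) * ∑ i ∈ s, ‖u i‖ ^ 2 + (1 + 1 / a) * ∑ i ∈ s, ‖w i‖ ^ 2 := by
  rw [Finset.mul_sum, Finset.mul_sum, ← Finset.sum_add_distrib]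
  exact Finset.sum_le_sum fun i _ => norm_add_sq_le ha _ _

lemma inner_sub_sub_nonpos_of_isMinOn_norm {S : Set E} (hS : Convex ℝ S) {p u : E} (hu : u ∈ S)
    (hmin : IsMinOn (fun w => ‖w - p‖) S u) {w : E} (hw : w ∈ S) :
    inner ℝ (p - u) (w - u) ≤ 0 := by
  refine (norm_eq_iInf_iff_real_inner_le_zero hS hu).1 ?_ w hw
  have : Nonempty S := ⟨⟨u, hu⟩⟩
  have bddBelow : BddBelow (Set.range fun w : S => ‖p - w‖) :=
    ⟨0, Set.forall_mem_range.2 fun _ => norm_nonneg _⟩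
  refine le_antisymm (le_ciInf fun w => ?_) (ciInf_le bddBelow ⟨u, hu⟩)
  simpa only [norm_sub_rev] using isMinOn_iff.1 hmin w w.2

lemma sub_le_inner_gradient_add_sq [CompleteSpace E] {f : E → ℝ} (hf : Differentiable ℝ f)
    {S : Set E} (hS : Convex ℝ S) {L : ℝ}
    (hlip : ∀ a ∈ S, ∀ b ∈ S, ‖∇ f a - ∇ f b‖ ≤ L * ‖a - b‖) {a b : E} (ha : a ∈ S)
    (hb : b ∈ S) :
    f b - f a ≤ inner ℝ (∇ f a) (b - a) + L / 2 * ‖b - a‖ ^ 2 := by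
  let g : ℝ → ℝ := fun s =>
    f (a + s • (b - a)) - s * inner ℝ (∇ f a) (b - a) - L / 2 * s ^ 2 * ‖b - a‖ ^ 2
  have hasDerivAt_g (s : ℝ) : HasDerivAt g
      (inner ℝ (∇ f (a + s • (b - a)) - ∇ f a) (b - a) - L * s * ‖b - a‖ ^ 2) s := by
    have line : HasDerivAt (fun s : ℝ => a + s • (b - a)) (b - a) s := by
      simpa using ((hasDerivAt_id s).smul_const (b - a)).const_add a
    have := ((((hf _).hasFDerivAt.comp_hasDerivAt s line).sub
      ((hasDerivAt_id s).mul_const (inner ℝ (∇ f a) (b - a)))).sub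
      (((hasDerivAt_pow 2 s).const_mul (L / 2)).mul_const (‖b - a‖ ^ 2)))
    refine HasDerivAt.congr_deriv (f := g) this ?_
    rw [inner_sub_left, inner_gradient_left, inner_gradient_left]
    push_cast
    ring
  have deriv_nonpos : ∀ s ∈ interior (Set.Icc (0 : ℝ) 1), deriv g s ≤ 0 := by
    intro s hs
    rw [interior_Icc] at hs
    rw [(hasDerivAt_g s).deriv, sub_nonpos]
    have mem : a + s • (b - a) ∈ S := hS.add_smul_sub_mem ha hb (Set.Ioo_subset_Icc_self hs)
    calc inner ℝ (∇ f (a + s • (b - a)) - ∇ f a) (b - a)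
        ≤ ‖∇ f (a + s • (b - a)) - ∇ f a‖ * ‖b - a‖ := real_inner_le_norm _ _
      _ ≤ L * ‖a + s • (b - a) - a‖ * ‖b - a‖ := by gcongr; exact hlip _ mem _ ha
      _ = L * s * ‖b - a‖ ^ 2 := by
        rw [add_sub_cancel_left, norm_smul, Real.norm_of_nonneg hs.1.le]
        ring
  have antitone : g 1 ≤ g 0 :=
    antitoneOn_of_deriv_nonpos (convex_Icc 0 1)
      (fun s _ => (hasDerivAt_g s).continuousAt.continuousWithinAt)
      (fun s _ => (hasDerivAt_g s).differentiableAt.differentiableWithinAt) deriv_nonpos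
      (by simp) (by simp) zero_le_one
  simp only [g, one_smul, add_sub_cancel, zero_smul, add_zero] at antitone
  linarith

end InnerProductSpace

variable {N K : ℕ}

section Average

lemma avg_add (x y : Fin N → Vec K) : avg (x + y) = avg x + avg y := by
  simp [avg, Finset.sum_add_distrib, smul_add]

lemma avg_sub (x y : Fin N → Vec K) : avg (x - y) = avg x - avg y := by
  simp [avg, Finset.sum_sub_distrib, smul_sub]

lemma avg_smul (c : ℝ) (x : Fin N → Vec K) : avg (c • x) = c • avg x := by
  simp [avg, ← Finset.smul_sum, smul_comm c]

lemma natCast_smul_avg (x : Fin N → Vec K) : (N : ℝ) • avg x = ∑ i, x i := by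
  rcases N.eq_zero_or_pos with rfl | hN
  · simp
  · simp [avg, smul_smul, hN.ne']

lemma inner_avg (u : Vec K) (x : Fin N → Vec K) :
    inner ℝ u (avg x) = 1 / (N : ℝ) * ∑ i, inner ℝ u (x i) := by
  simp [avg, inner_smul_right, inner_sum]

lemma avg_mem (hN : 0 < N) {S : Set (Vec K)} (hS : Convex ℝ S) {x : Fin N → Vec K}
    (hx : ∀ i, x i ∈ S) : avg x ∈ S := by
  rw [avg, Finset.smul_sum]
  exact hS.sum_mem (fun _ _ => by positivity) (by simp [hN.ne']) fun i _ => hx i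

lemma norm_avg_sq_le (x : Fin N → Vec K) :
    ‖avg x‖ ^ 2 ≤ 1 / (N : ℝ) * ∑ i, ‖x i‖ ^ 2 := by
  rcases N.eq_zero_or_pos with rfl | hN
  · simp [avg]
  · rw [avg, Finset.smul_sum, Finset.mul_sum]
    exact convexOn_norm_sq.map_sum_le (w := fun _ => 1 / (N : ℝ)) (fun _ _ => by positivity)
      (by simp [hN.ne']) fun _ _ => Set.mem_univ _

lemma consensusError_nonneg (x : Fin N → Vec K) : 0 ≤ consensusError x :=
  Finset.sum_nonneg fun _ _ => by positivity

lemma norm_sub_avg_sq_le (x : Fin N → Vec K) (i : Fin N) :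
    ‖x i - avg x‖ ^ 2 ≤ consensusError x :=
  Finset.single_le_sum (f := fun i => ‖x i - avg x‖ ^ 2) (fun _ _ => by positivity)
    (Finset.mem_univ i)

lemma sum_sub_avg (x : Fin N → Vec K) : ∑ i, (x i - avg x) = 0 := by
  rw [Finset.sum_sub_distrib, ← natCast_smul_avg]
  simp [Nat.cast_smul_eq_nsmul]

lemma consensusError_eq (x : Fin N → Vec K) :
    consensusError x = ∑ i, ‖x i‖ ^ 2 - N * ‖avg x‖ ^ 2 := by
  have cross : ∑ i, inner ℝ (x i) (avg x) = N * ‖avg x‖ ^ 2 := by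
    rw [← sum_inner, ← natCast_smul_avg, real_inner_smul_left, real_inner_self_eq_norm_sq]
  simp only [consensusError, norm_sub_sq_real, Finset.sum_add_distrib, Finset.sum_sub_distrib,
    ← Finset.mul_sum, cross, Finset.sum_const, Finset.card_univ, Fintype.card_fin, nsmul_eq_mul]
  ring

lemma consensusError_le_sum_norm_sq (x : Fin N → Vec K) :
    consensusError x ≤ ∑ i, ‖x i‖ ^ 2 := by
  rw [consensusError_eq]
  exact sub_le_self _ (by positivity)

lemma consensusError_add_le {a : ℝ} (ha : 0 < a) (x y : Fin N → Vec K) :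
    consensusError (x + y) ≤ (1 + a) * consensusError x + (1 + 1 / a) * ∑ i, ‖y i‖ ^ 2 :=
  calc consensusError (x + y)
      ≤ (1 + a) * consensusError x + (1 + 1 / a) * consensusError y := by
        simpa only [consensusError, avg_add, Pi.add_apply, add_sub_add_comm] using
          sum_norm_add_sq_le Finset.univ ha (fun i => x i - avg x) (fun i => y i - avg y)
    _ ≤ (1 + a) * consensusError x + (1 + 1 / a) * ∑ i, ‖y i‖ ^ 2 := by
        gcongr
        exact consensusError_le_sum_norm_sq y

end Average

section Mixing

/-- The stacked vector `(W ⊗ I) x`: every agent takes the `W`-weighted sum of all blocks. -/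
noncomputable def mix (W : Matrix (Fin N) (Fin N) ℝ) (x : Fin N → Vec K) : Fin N → Vec K :=
  fun i => ∑ j, W i j • x j

variable {W : Matrix (Fin N) (Fin N) ℝ}

lemma mix_apply (W : Matrix (Fin N) (Fin N) ℝ) (x : Fin N → Vec K) (i : Fin N) (k : Fin K) :
    mix W x i k = W.mulVec (fun j => x j k) i := by
  simp [mix, Matrix.mulVec, dotProduct]

lemma mix_add (W : Matrix (Fin N) (Fin N) ℝ) (x y : Fin N → Vec K) :
    mix W (x + y) = mix W x + mix W y := by
  funext i
  simp [mix, smul_add, Finset.sum_add_distrib]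

lemma mix_sub_const (hW : W ∈ doublyStochastic ℝ (Fin N)) (x : Fin N → Vec K) (c : Vec K)
    (i : Fin N) : mix W (fun j => x j - c) i = mix W x i - c := by
  simp [mix, smul_sub, Finset.sum_sub_distrib, ← Finset.sum_smul,
    sum_row_of_mem_doublyStochastic hW i]

lemma mix_mem (hW : W ∈ doublyStochastic ℝ (Fin N)) {S : Set (Vec K)} (hS : Convex ℝ S)
    {x : Fin N → Vec K} (hx : ∀ i, x i ∈ S) (i : Fin N) : mix W x i ∈ S :=
  hS.sum_mem (fun _ _ => nonneg_of_mem_doublyStochastic hW)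
    (sum_row_of_mem_doublyStochastic hW i) fun j _ => hx j

lemma avg_mix (hW : W ∈ doublyStochastic ℝ (Fin N)) (x : Fin N → Vec K) :
    avg (mix W x) = avg x := by
  simp only [avg, mix]
  rw [Finset.sum_comm]
  simp [← Finset.sum_smul, sum_col_of_mem_doublyStochastic hW]

lemma sum_norm_mix_sq_le (hW : W ∈ doublyStochastic ℝ (Fin N)) (x : Fin N → Vec K) :
    ∑ i, ‖mix W x i‖ ^ 2 ≤ ∑ i, ‖x i‖ ^ 2 :=
  calc ∑ i, ‖mix W x i‖ ^ 2 ≤ ∑ i, ∑ j, W i j * ‖x j‖ ^ 2 :=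
        Finset.sum_le_sum fun i _ => convexOn_norm_sq.map_sum_le
          (fun _ _ => nonneg_of_mem_doublyStochastic hW)
          (sum_row_of_mem_doublyStochastic hW i) fun _ _ => Set.mem_univ _
    _ = ∑ i, ‖x i‖ ^ 2 := by
        rw [Finset.sum_comm]
        simp [← Finset.sum_mul, sum_col_of_mem_doublyStochastic hW]

lemma sum_norm_mix_sub_sq_le (hW : W ∈ doublyStochastic ℝ (Fin N)) (x : Fin N → Vec K) :
    ∑ i, ‖mix W x i - x i‖ ^ 2 ≤ 4 * consensusError x := by
  have split := sum_norm_add_sq_le Finset.univ one_pos (fun i => mix W x i - avg x)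
    (fun i => avg x - x i)
  have mixed : ∑ i, ‖mix W x i - avg x‖ ^ 2 ≤ consensusError x := by
    simpa only [mix_sub_const hW, consensusError] using
      sum_norm_mix_sq_le hW fun i => x i - avg x
  have unmixed : ∑ i, ‖avg x - x i‖ ^ 2 = consensusError x := by
    simp only [consensusError, norm_sub_rev]
  simp only [sub_add_sub_cancel] at split
  linarith

lemma sum_norm_mix_add_sub_sq_le (hW : W ∈ doublyStochastic ℝ (Fin N)) (x d : Fin N → Vec K) :
    ∑ i, ‖mix W (x + d) i - x i‖ ^ 2 ≤ 8 * consensusError x + 2 * ∑ i, ‖d i‖ ^ 2 := by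
  have split := sum_norm_add_sq_le Finset.univ one_pos (fun i => mix W x i - x i) (mix W d)
  have consensus_part := sum_norm_mix_sub_sq_le hW x
  have step_part := sum_norm_mix_sq_le hW d
  simp only [mix_add, Pi.add_apply, add_sub_right_comm]
  linarith

/-- Doubly stochastic matrices that contract the vectors orthogonal to the constants by the
factor `η`: the two ways in which mixing with `W` enters the analysis. -/
structure IsAveragingMatrix (W : Matrix (Fin N) (Fin N) ℝ) (η : ℝ) : Prop where
  doublyStochastic : W ∈ doublyStochastic ℝ (Fin N)
  contract : ∀ u : Fin N → ℝ, ∑ i, u i = 0 →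
    ∑ i, W.mulVec u i ^ 2 ≤ η ^ 2 * ∑ i, u i ^ 2

variable {η : ℝ}

lemma IsAveragingMatrix.consensusError_mix_le (hW : IsAveragingMatrix W η)
    (x : Fin N → Vec K) : consensusError (mix W x) ≤ η ^ 2 * consensusError x := by
  have coordinates (w : Fin N → Vec K) : ∑ i, ‖w i‖ ^ 2 = ∑ k, ∑ i, w i k ^ 2 := by
    simp only [EuclideanSpace.norm_sq_eq, Real.norm_eq_abs, sq_abs]
    exact Finset.sum_comm
  simp only [consensusError, avg_mix hW.doublyStochastic, ← mix_sub_const hW.doublyStochastic]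
  rw [coordinates, coordinates, Finset.mul_sum]
  refine Finset.sum_le_sum fun k _ => ?_
  simp only [mix_apply]
  exact hW.contract _ (by simpa using congrArg (fun u : Vec K => u k) (sum_sub_avg x))

lemma IsAveragingMatrix.consensusError_mix_add_le (hW : IsAveragingMatrix W η) {a : ℝ}
    (ha : 0 < a) (x d : Fin N → Vec K) :
    consensusError (mix W (x + d)) ≤
      (1 + a) * η ^ 2 * consensusError x + η ^ 2 * (1 + 1 / a) * ∑ i, ‖d i‖ ^ 2 :=
  calc consensusError (mix W (x + d)) ≤ η ^ 2 * consensusError (x + d) :=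
        hW.consensusError_mix_le _
    _ ≤ η ^ 2 * ((1 + a) * consensusError x + (1 + 1 / a) * ∑ i, ‖d i‖ ^ 2) := by
        gcongr
        exact consensusError_add_le ha x d
    _ = _ := by ring

lemma IsAveragingMatrix.consensusError_mix_add_error_le (hW : IsAveragingMatrix W η) {a : ℝ}
    (ha : 0 < a) (y e : Fin N → Vec K) :
    consensusError (mix W y + e) ≤
      (1 + a) * η ^ 2 * consensusError y + (1 + 1 / a) * ∑ i, ‖e i‖ ^ 2 := by
  refine (consensusError_add_le ha _ _).trans ?_
  rw [mul_assoc]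
  gcongr
  exact hW.consensusError_mix_le y

end Mixing

section Spectral

lemma sum_mulVec_sq_le_of_eigenvalues {n : Type*} [Fintype n] [DecidableEq n]
    {A : Matrix n n ℝ} (hA : A.IsHermitian) {c : ℝ} {u : n → ℝ}
    (h : ∀ k, |hA.eigenvalues k| ≤ c ∨ inner ℝ (hA.eigenvectorBasis k) (WithLp.toLp 2 u) = 0) :
    ∑ i, A.mulVec u i ^ 2 ≤ c ^ 2 * ∑ i, u i ^ 2 := by
  set b := hA.eigenvectorBasis
  have parseval (w : n → ℝ) : ∑ i, w i ^ 2 = ∑ k, inner ℝ (b k) (WithLp.toLp 2 w) ^ 2 := by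
    simpa [EuclideanSpace.norm_sq_eq] using (b.sum_sq_norm_inner_right (WithLp.toLp 2 w)).symm
  have diagonal (k : n) : inner ℝ (b k) (WithLp.toLp 2 (A.mulVec u)) =
      hA.eigenvalues k * inner ℝ (b k) (WithLp.toLp 2 u) := by
    have vecMul_eq : Matrix.vecMul (b k).ofLp A = hA.eigenvalues k • (b k).ofLp := by
      rw [← hA.mulVec_eigenvectorBasis k, ← Matrix.mulVec_transpose,
        ← Matrix.conjTranspose_eq_transpose_of_trivial, hA.eq]
    simp only [EuclideanSpace.inner_eq_star_dotProduct, star_trivial]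
    rw [dotProduct_comm, Matrix.dotProduct_mulVec, vecMul_eq, smul_dotProduct, dotProduct_comm,
      smul_eq_mul]
  rw [parseval (A.mulVec u), parseval u, Finset.mul_sum]
  refine Finset.sum_le_sum fun k _ => ?_
  rw [diagonal, mul_pow, ← sq_abs (hA.eigenvalues k)]
  rcases h k with small | orthogonal
  · gcongr
  · simp [orthogonal]

variable {G : SimpleGraph (Fin N)} {W : Matrix (Fin N) (Fin N) ℝ}

lemma abs_le_secondEigenvalue {μ : ℝ} (hμ : μ ≠ 1)
    (h : Module.End.HasEigenvalue (Matrix.toLin' W) μ) : |μ| ≤ secondEigenvalue W := by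
  refine le_csSup ?_ ⟨μ, hμ, h, rfl⟩
  refine (((Module.End.finite_hasEigenvalue (Matrix.toLin' W)).image fun μ => |μ|).subset
    ?_).bddAbove
  rintro _ ⟨μ, -, h, rfl⟩
  exact ⟨μ, h, rfl⟩

lemma hasEigenvalue_eigenvalues {n : Type*} [Fintype n] [DecidableEq n] {A : Matrix n n ℝ}
    (hA : A.IsHermitian) (k : n) :
    Module.End.HasEigenvalue (Matrix.toLin' A) (hA.eigenvalues k) := by
  refine Module.End.hasEigenvalue_of_hasEigenvector (x := (hA.eigenvectorBasis k).ofLp) ⟨?_, ?_⟩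
  · rw [Module.End.mem_eigenspace_iff, Matrix.toLin'_apply, hA.mulVec_eigenvectorBasis k]
  · exact (WithLp.ofLp_eq_zero 2).ne.2 (hA.eigenvectorBasis.toBasis.ne_zero k)

lemma IsMixingMatrix.mem_doublyStochastic (hW : IsMixingMatrix G W) :
    W ∈ doublyStochastic ℝ (Fin N) := by
  have mulVec_one : W.mulVec 1 = 1 := by
    have h := (hW.null 1).2 ⟨1, rfl⟩
    rwa [Matrix.sub_mulVec, Matrix.one_mulVec, sub_eq_zero, eq_comm] at h
  refine _root_.mem_doublyStochastic.2 ⟨fun i j => ?_, mulVec_one, ?_⟩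
  · rcases eq_or_ne i j with rfl | hij
    · exact hW.diag_nonneg i
    · by_cases hG : G.Adj i j
      · exact (hW.pos_of_adj i j hG).le
      · exact (hW.zero_of_not_adj i j hij hG).ge
  · rw [← Matrix.mulVec_transpose, hW.symm.eq, mulVec_one]

lemma IsMixingMatrix.isAveragingMatrix (hW : IsMixingMatrix G W) :
    IsAveragingMatrix W (secondEigenvalue W) := by
  have hermitian : W.IsHermitian := by
    rw [Matrix.IsHermitian, Matrix.conjTranspose_eq_transpose_of_trivial, hW.symm.eq]
  refine ⟨hW.mem_doublyStochastic, fun u hu => sum_mulVec_sq_le_of_eigenvalues hermitian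
    fun k => ?_⟩
  by_cases eigenvalue_one : hermitian.eigenvalues k = 1
  · right
    obtain ⟨c, hc⟩ := (hW.null (hermitian.eigenvectorBasis k).ofLp).1 (by
      rw [Matrix.sub_mulVec, Matrix.one_mulVec, hermitian.mulVec_eigenvectorBasis k,
        eigenvalue_one, one_smul, sub_self])
    simp [EuclideanSpace.inner_eq_star_dotProduct, hc, dotProduct, ← Finset.sum_mul, hu]
  · exact .inl (abs_le_secondEigenvalue eigenvalue_one (hasEigenvalue_eigenvalues hermitian k))

end Spectral

section LocalModel

variable {α : ℝ} {S : Set (Vec K)} {y x u : Vec K}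

lemma localModel_eq (hα : α ≠ 0) (y x u : Vec K) :
    localModel α y x u = 1 / (2 * α) * ‖u - (x - α • y)‖ ^ 2 - α / 2 * ‖y‖ ^ 2 := by
  rw [show u - (x - α • y) = (u - x) + α • y by abel, norm_add_sq_real, inner_smul_right,
    norm_smul, mul_pow, Real.norm_eq_abs, sq_abs, localModel, real_inner_comm]
  field_simp
  ring

lemma localModel_le_localModel_iff (hα : 0 < α) {w : Vec K} :
    localModel α y x u ≤ localModel α y x w ↔ ‖u - (x - α • y)‖ ≤ ‖w - (x - α • y)‖ := by
  rw [localModel_eq hα.ne', localModel_eq hα.ne', sub_le_sub_iff_right,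
    mul_le_mul_iff_right₀ (by positivity), sq_le_sq₀ (norm_nonneg _) (norm_nonneg _)]

lemma convexOn_localModel (hα : 0 < α) (y x : Vec K) :
    ConvexOn ℝ Set.univ (localModel α y x) := by
  have h := ((convexOn_norm_sq (E := Vec K)).translate_right (-(x - α • y))).smul
    (show 0 ≤ 1 / (2 * α) by positivity)
  refine (h.add_const (-(α / 2 * ‖y‖ ^ 2))).congr fun u _ => ?_
  simp [localModel_eq hα.ne', sub_eq_add_neg, add_comm]

-- The minimizer is the projection of `x - α y` onto `S`, and the projection inequality is
-- tested at `x`.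
lemma inner_le_of_isMinOn_localModel (hα : 0 < α) (hS : Convex ℝ S) (hx : x ∈ S) (hu : u ∈ S)
    (h : IsMinOn (localModel α y x) S u) : inner ℝ y (u - x) ≤ -(1 / α * ‖u - x‖ ^ 2) := by
  have hproj := inner_sub_sub_nonpos_of_isMinOn_norm (p := x - α • y) hS hu
    (fun w hw => (localModel_le_localModel_iff hα).1 (h hw)) hx
  rw [show x - α • y - u = -(u - x) - α • y by abel, ← neg_sub u x, inner_sub_left,
    inner_neg_neg, inner_neg_right, real_inner_smul_left, real_inner_self_eq_norm_sq] at hproj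
  rw [← neg_mul, ← neg_div, div_mul_eq_mul_div, le_div_iff₀ hα]
  linarith

lemma isMinOn_univ_localModel_iff (hα : 0 < α) :
    IsMinOn (localModel α y x) Set.univ u ↔ u = x - α • y := by
  simp only [isMinOn_univ_iff, localModel_le_localModel_iff hα]
  refine ⟨fun h => ?_, fun h w => by simp [h]⟩
  simpa [sub_eq_zero] using h (x - α • y)

lemma isMinOn_univ_of_mem_interior (hα : 0 < α) (hu : u ∈ interior S)
    (h : IsMinOn (localModel α y x) S u) : IsMinOn (localModel α y x) Set.univ u :=
  isMinOn_univ_iff.2 <| IsMinOn.of_isLocalMin_of_convex_univ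
    (h.isLocalMin (mem_interior_iff_mem_nhds.1 hu)) (convexOn_localModel hα y x)

end LocalModel

section Descent

variable {f : Fin N → Vec K → ℝ} {S : Set (Vec K)} {L : ℝ}

lemma avgFun_sub_le (hN : 0 < N) (hf : ∀ i, Differentiable ℝ (f i)) (hS : Convex ℝ S)
    (hlip : ∀ i, ∀ a ∈ S, ∀ b ∈ S, ‖∇ (f i) a - ∇ (f i) b‖ ≤ L * ‖a - b‖) {a b : Vec K}
    (ha : a ∈ S) (hb : b ∈ S) :
    avgFun f b - avgFun f a ≤
      inner ℝ (avg fun i => ∇ (f i) a) (b - a) + L / 2 * ‖b - a‖ ^ 2 := by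
  have mean : avgFun f b - avgFun f a ≤
      1 / (N : ℝ) * ∑ i, (inner ℝ (b - a) (∇ (f i) a) + L / 2 * ‖b - a‖ ^ 2) := by
    rw [avgFun, avgFun, ← mul_sub, ← Finset.sum_sub_distrib]
    gcongr with i
    rw [real_inner_comm]
    exact sub_le_inner_gradient_add_sq (hf i) hS (hlip i) ha hb
  rw [Finset.sum_add_distrib, mul_add, ← inner_avg, real_inner_comm] at mean
  simpa [hN.ne'] using mean

lemma sum_norm_gradient_sub_sq_le
    (hlip : ∀ i, ∀ a ∈ S, ∀ b ∈ S, ‖∇ (f i) a - ∇ (f i) b‖ ≤ L * ‖a - b‖)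
    {x x' : Fin N → Vec K} (hx : ∀ i, x i ∈ S) (hx' : ∀ i, x' i ∈ S) :
    ∑ i, ‖∇ (f i) (x' i) - ∇ (f i) (x i)‖ ^ 2 ≤ L ^ 2 * ∑ i, ‖x' i - x i‖ ^ 2 := by
  rw [Finset.mul_sum]
  gcongr with i
  rw [← mul_pow]
  gcongr
  exact hlip i _ (hx' i) _ (hx i)

lemma norm_avg_gradient_sub_sq_le
    (hlip : ∀ i, ∀ a ∈ S, ∀ b ∈ S, ‖∇ (f i) a - ∇ (f i) b‖ ≤ L * ‖a - b‖)
    {x : Fin N → Vec K} (hx : ∀ i, x i ∈ S) (havg : avg x ∈ S) :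
    ‖(avg fun i => ∇ (f i) (avg x)) - avg fun i => ∇ (f i) (x i)‖ ^ 2 ≤
      1 / N * (L ^ 2 * consensusError x) := by
  rw [← avg_sub]
  refine (norm_avg_sq_le _).trans ?_
  gcongr
  simpa only [consensusError, norm_sub_rev, Pi.sub_apply] using
    sum_norm_gradient_sub_sq_le hlip hx fun _ => havg

lemma inner_avg_avg_le {b : ℝ} (hb : 0 < b) (y d : Fin N → Vec K) :
    2 * inner ℝ (avg y) (avg d) ≤
      1 / N * (2 * ∑ i, inner ℝ (y i) (d i) + b * consensusError y + 1 / b * ∑ i, ‖d i‖ ^ 2) := by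
  rw [inner_avg, mul_left_comm]
  gcongr
  rw [consensusError, Finset.mul_sum, Finset.mul_sum, Finset.mul_sum, Finset.mul_sum,
    ← Finset.sum_add_distrib, ← Finset.sum_add_distrib]
  gcongr with i
  have split : inner ℝ (avg y) (d i) = inner ℝ (y i) (d i) + inner ℝ (avg y - y i) (d i) := by
    rw [inner_sub_left]
    ring
  have young := two_mul_inner_le hb (avg y - y i) (d i)
  rw [norm_sub_rev] at young
  linarith

lemma avgFun_avg_add_half_smul_le (hN : 0 < N) (hf : ∀ i, Differentiable ℝ (f i))
    (hS : Convex ℝ S) (hL : 0 < L)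
    (hlip : ∀ i, ∀ a ∈ S, ∀ b ∈ S, ‖∇ (f i) a - ∇ (f i) b‖ ≤ L * ‖a - b‖)
    {α : ℝ} {x y d : Fin N → Vec K} (hx : ∀ i, x i ∈ S) (hxd : ∀ i, (x + d) i ∈ S)
    (hd : ∀ i, inner ℝ (y i) (d i) ≤ -(1 / α * ‖d i‖ ^ 2))
    (hy : avg y = avg fun i => ∇ (f i) (x i)) {p s : ℝ} (hp : 0 < p) (hs : 0 < s) :
    avgFun f (avg (x + (1 / 2 : ℝ) • d)) ≤
      avgFun f (avg x) + p * consensusError x + s * consensusError y +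
        (L ^ 2 / (16 * p * N ^ 2) + 1 / (16 * s * N ^ 2) + L / (8 * N) - 1 / (2 * (N * α))) *
          ∑ i, ‖d i‖ ^ 2 := by
  set D := ∑ i, ‖d i‖ ^ 2
  have avg_x_mem := avg_mem hN hS hx
  have avg_next_mem : avg x + (1 / 2 : ℝ) • avg d ∈ S :=
    hS.add_smul_mem avg_x_mem (avg_add x d ▸ avg_mem hN hS hxd) ⟨by norm_num, by norm_num⟩
  have step : ‖avg d‖ ^ 2 ≤ 1 / N * D := norm_avg_sq_le d
  set g := avg fun i => ∇ (f i) (avg x)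
  have gradient_error : 2 * inner ℝ (g - avg y) (avg d) ≤
      4 * N * p / L ^ 2 * (1 / N * (L ^ 2 * consensusError x)) +
        1 / (4 * N * p / L ^ 2) * (1 / N * D) := by
    have bound := norm_avg_gradient_sub_sq_le hlip hx avg_x_mem
    rw [← hy] at bound
    exact (two_mul_inner_le (a := 4 * N * p / L ^ 2) (by positivity) _ _).trans (by gcongr)
  have local_decrease : ∑ i, inner ℝ (y i) (d i) ≤ -(1 / α * D) := by
    rw [Finset.mul_sum, ← Finset.sum_neg_distrib]
    exact Finset.sum_le_sum fun i _ => hd i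
  have tracker_error : 2 * inner ℝ (avg y) (avg d) ≤
      1 / N * (2 * (-(1 / α * D)) + 4 * N * s * consensusError y + 1 / (4 * N * s) * D) :=
    (inner_avg_avg_le (b := 4 * N * s) (by positivity) y d).trans (by gcongr)
  calc avgFun f (avg (x + (1 / 2 : ℝ) • d))
      ≤ avgFun f (avg x) + (2 * inner ℝ (g - avg y) (avg d)) / 4 +
          (2 * inner ℝ (avg y) (avg d)) / 4 + L / 8 * ‖avg d‖ ^ 2 := by
        have descent := avgFun_sub_le hN hf hS hlip avg_x_mem avg_next_mem
        rw [add_sub_cancel_left, inner_smul_right, norm_smul, mul_pow, Real.norm_eq_abs,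
          sq_abs] at descent
        rw [avg_add, avg_smul, inner_sub_left]
        linarith
    _ ≤ avgFun f (avg x) +
          (4 * N * p / L ^ 2 * (1 / N * (L ^ 2 * consensusError x)) +
            1 / (4 * N * p / L ^ 2) * (1 / N * D)) / 4 +
          1 / N * (2 * (-(1 / α * D)) + 4 * N * s * consensusError y +
            1 / (4 * N * s) * D) / 4 + L / 8 * (1 / N * D) := by
        gcongr
    _ = _ := by
        field_simp
        ring

end Descent

section StepSize

variable {α γ ξ η L : ℝ}

lemma stepSize_pos (hN : 0 < N) (hγ : 0 < γ) (hξ : 0 < ξ) (hγη : (1 + γ) * η ^ 2 < 1)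
    (hξη : (1 + ξ) * η ^ 2 < 1) (hL : 0 < L) : 0 < stepSize N γ ξ η L := by
  rw [← sub_pos] at hγη hξη
  exact lt_min (lt_min (by positivity) (by positivity)) one_pos

lemma eight_mul_le_of_le_stepSize (hN : 0 < N) (hγ : 0 < γ) (hL : 0 < L) (hα : 0 < α)
    (hαle : α ≤ stepSize N γ ξ η L) :
    8 * (L / (2 * N) + (1 / γ + 5 / 4)) ≤ 1 / (N * α) := by
  have first_bound := hαle.trans ((min_le_left _ _).trans (min_le_left _ _))
  rw [div_mul_div_comm, one_mul, le_div_iff₀ (by positivity)] at first_bound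
  rw [le_div_iff₀ (by positivity)]
  linarith

lemma mul_le_tenth_of_le_stepSize (hN : 0 < N) (hγ : 0 < γ) (hL : 0 < L) (hα : 0 < α)
    (hαle : α ≤ stepSize N γ ξ η L) : N * α ≤ 1 / 10 := by
  have ten_le : 10 ≤ 1 / (N * α) := by
    refine le_trans ?_ (eight_mul_le_of_le_stepSize hN hγ hL hα hαle)
    have : 0 < L / (2 * N) + 1 / γ := by positivity
    linarith
  exact (le_one_div (by norm_num) (by positivity)).1 ten_le

lemma sixtyfour_mul_le_of_le_stepSize (hN : 0 < N) (hξ : 0 < ξ) (hγη : (1 + γ) * η ^ 2 < 1)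
    (hξη : (1 + ξ) * η ^ 2 < 1) (hL : 0 < L) (hα : 0 < α) (hαle : α ≤ stepSize N γ ξ η L) :
    64 * ((1 + 1 / ξ) * L ^ 2 / ((1 - (1 + γ) * η ^ 2) * (1 - (1 + ξ) * η ^ 2) * N ^ 2)) ≤
      1 / (N * α) := by
  rw [← sub_pos] at hγη hξη
  have second_bound := hαle.trans ((min_le_left _ _).trans (min_le_right _ _))
  rw [le_div_iff₀ (by positivity)] at second_bound
  rw [← mul_div_assoc, div_le_div_iff₀ (by positivity) (by positivity)]
  have := mul_le_mul_of_nonneg_left second_bound (Nat.cast_nonneg (α := ℝ) N)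
  linarith

lemma step_coefficient_le (hN : 0 < N) (hγ : 0 < γ) (hξ : 0 < ξ) (hγη : (1 + γ) * η ^ 2 < 1)
    (hξη : (1 + ξ) * η ^ 2 < 1) (hL : 0 < L) (hα : 0 < α) (hαle : α ≤ stepSize N γ ξ η L) :
    L ^ 2 / (4 * (1 - (1 + γ) * η ^ 2) * N ^ 2) +
        2 * ((1 + 1 / ξ) * L ^ 2 / ((1 - (1 + γ) * η ^ 2) * (1 - (1 + ξ) * η ^ 2) * N ^ 2)) +
        L / (8 * N) + 1 / (4 * γ) + 1 / 64 ≤ 1 / (4 * (N * α)) := by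
  have first_bound := eight_mul_le_of_le_stepSize hN hγ hL hα hαle
  have second_bound := sixtyfour_mul_le_of_le_stepSize hN hξ hγη hξη hL hα hαle
  have : 0 ≤ (1 + ξ) * η ^ 2 := by positivity
  rw [← sub_pos] at hγη hξη
  set δ := 1 - (1 + γ) * η ^ 2
  have dominated : L ^ 2 / (4 * δ * N ^ 2) ≤
      (1 + 1 / ξ) * L ^ 2 / (δ * (1 - (1 + ξ) * η ^ 2) * N ^ 2) := by
    have : 0 < 1 / ξ := by positivity
    refine div_le_div₀ (by positivity) (le_mul_of_one_le_left (by positivity) (by linarith))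
      (by positivity) ?_
    rw [mul_comm 4 δ]
    gcongr
    linarith
  rw [show 1 / (4 * (N * α)) = 1 / 4 * (1 / (N * α)) by ring]
  rw [show L / (8 * N) = 1 / 4 * (L / (2 * N)) by ring, show 1 / (4 * γ) = 1 / 4 * (1 / γ) by ring]
  have : 0 < L / (2 * N) := by positivity
  have : 0 < 1 / γ := by positivity
  linarith

end StepSize

section Potential

variable {f : Fin N → Vec K → ℝ} {γ ξ η : ℝ}

lemma avgFun_le_potential (hξ : 0 < ξ) (hγη : (1 + γ) * η ^ 2 ≤ 1) (L : ℝ)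
    (x y : Fin N → Vec K) : avgFun f (avg x) ≤ potential f γ ξ η L x y := by
  rw [← sub_nonneg] at hγη
  have := consensusError_nonneg x
  have := consensusError_nonneg y
  rw [potential, add_assoc]
  exact le_add_of_nonneg_right (by positivity)

lemma potential_antitone (hξ : 0 < ξ) (hγη : (1 + γ) * η ^ 2 ≤ 1) {L₁ L₂ : ℝ} (hL : 0 < L₁)
    (h : L₁ ≤ L₂) (x y : Fin N → Vec K) :
    potential f γ ξ η L₂ x y ≤ potential f γ ξ η L₁ x y := by
  rw [← sub_nonneg] at hγη
  have := consensusError_nonneg y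
  unfold potential
  gcongr

/-- The guaranteed decrease of the potential in an inner iteration that starts from `x` and whose
constrained minimizers are `x + d`; here `δ` is the contraction margin `1 - (1 + γ) η²`. -/
noncomputable def stepDecrease (α δ : ℝ) (x d : Fin N → Vec K) : ℝ :=
  1 / (4 * (N * α)) * ∑ i, ‖d i‖ ^ 2 + δ / 2 * consensusError x

lemma stepDecrease_nonneg {α δ : ℝ} (hα : 0 ≤ α) (hδ : 0 ≤ δ) (x d : Fin N → Vec K) :
    0 ≤ stepDecrease α δ x d := by
  have := consensusError_nonneg x
  unfold stepDecrease
  positivity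

lemma sum_norm_half_smul_sq (d : Fin N → Vec K) :
    ∑ i, ‖((1 / 2 : ℝ) • d) i‖ ^ 2 = 1 / 4 * ∑ i, ‖d i‖ ^ 2 := by
  rw [Finset.mul_sum]
  refine Finset.sum_congr rfl fun i _ => ?_
  rw [Pi.smul_apply, norm_smul, mul_pow]
  norm_num

variable {W : Matrix (Fin N) (Fin N) ℝ} {S : Set (Vec K)} {L : ℝ} {x y d : Fin N → Vec K}

lemma IsAveragingMatrix.consensusError_half_step_le (hW : IsAveragingMatrix W η) (hγ : 0 < γ)
    (hγη : (1 + γ) * η ^ 2 ≤ 1) (x d : Fin N → Vec K) :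
    consensusError (mix W (x + (1 / 2 : ℝ) • d)) ≤
      (1 + γ) * η ^ 2 * consensusError x + 1 / (4 * γ) * ∑ i, ‖d i‖ ^ 2 := by
  have factor : η ^ 2 * (1 + 1 / γ) ≤ 1 / γ := by
    rw [le_div_iff₀ hγ, mul_assoc, one_add_mul, one_div_mul_cancel hγ.ne']
    linarith
  calc consensusError (mix W (x + (1 / 2 : ℝ) • d))
      ≤ (1 + γ) * η ^ 2 * consensusError x +
          η ^ 2 * (1 + 1 / γ) * (1 / 4 * ∑ i, ‖d i‖ ^ 2) := by
        rw [← sum_norm_half_smul_sq]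
        exact hW.consensusError_mix_add_le hγ _ _
    _ ≤ (1 + γ) * η ^ 2 * consensusError x + 1 / γ * (1 / 4 * ∑ i, ‖d i‖ ^ 2) := by gcongr
    _ = _ := by ring

lemma IsAveragingMatrix.consensusError_tracking_le (hW : IsAveragingMatrix W η) (hξ : 0 < ξ)
    (hlip : ∀ i, ∀ a ∈ S, ∀ b ∈ S, ‖∇ (f i) a - ∇ (f i) b‖ ≤ L * ‖a - b‖)
    (hx : ∀ i, x i ∈ S) (hxn : ∀ i, mix W (x + (1 / 2 : ℝ) • d) i ∈ S) :
    consensusError (mix W y + fun i =>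
        ∇ (f i) (mix W (x + (1 / 2 : ℝ) • d) i) - ∇ (f i) (x i)) ≤
      (1 + ξ) * η ^ 2 * consensusError y +
        (1 + 1 / ξ) * (L ^ 2 * (8 * consensusError x + 1 / 2 * ∑ i, ‖d i‖ ^ 2)) := by
  have move := sum_norm_mix_add_sub_sq_le hW.doublyStochastic x ((1 / 2 : ℝ) • d)
  rw [sum_norm_half_smul_sq, ← mul_assoc, show (2 : ℝ) * (1 / 4) = 1 / 2 by norm_num] at move
  refine (hW.consensusError_mix_add_error_le hξ _ _).trans ?_
  gcongr
  exact (sum_norm_gradient_sub_sq_le hlip hx hxn).trans (by gcongr)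

-- Young's inequality is weighted so that it costs a quarter of the contraction margin `δ` of the
-- consensus error of `x` and all of the margin `δ'` of the weighted consensus error of `y`.
lemma avgFun_half_step_le (hN : 0 < N) (hf : ∀ i, Differentiable ℝ (f i)) (hS : Convex ℝ S)
    (hL : 0 < L) (hlip : ∀ i, ∀ a ∈ S, ∀ b ∈ S, ‖∇ (f i) a - ∇ (f i) b‖ ≤ L * ‖a - b‖)
    {α : ℝ} (hα : 0 < α) (hx : ∀ i, x i ∈ S) (hxd : ∀ i, (x + d) i ∈ S)
    (hmin : ∀ i, IsMinOn (localModel α (y i) (x i)) S ((x + d) i))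
    (hy : avg y = avg fun i => ∇ (f i) (x i)) {δ δ' q : ℝ} (hδ : 0 < δ) (hδ' : 0 < δ')
    (hq : 0 < q) :
    avgFun f (avg (x + (1 / 2 : ℝ) • d)) ≤
      avgFun f (avg x) + δ / 4 * consensusError x +
        δ / (32 * q * L ^ 2) * δ' * consensusError y +
        (L ^ 2 / (4 * δ * N ^ 2) + 2 * (q * L ^ 2 / (δ * δ' * N ^ 2)) + L / (8 * N) -
          1 / (2 * (N * α))) * ∑ i, ‖d i‖ ^ 2 := by
  have hd (i) : inner ℝ (y i) (d i) ≤ -(1 / α * ‖d i‖ ^ 2) := by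
    simpa using inner_le_of_isMinOn_localModel hα hS (hx i) (hxd i) (hmin i)
  refine (avgFun_avg_add_half_smul_le (p := δ / 4) (s := δ / (32 * q * L ^ 2) * δ') hN hf hS hL
    hlip hx hxd hd hy (by positivity) (by positivity)).trans_eq ?_
  congr 4
  field_simp
  ring

lemma IsAveragingMatrix.potential_add_stepDecrease_le (hW : IsAveragingMatrix W η) (hN : 0 < N)
    (hγ : 0 < γ) (hξ : 0 < ξ) (hγη : (1 + γ) * η ^ 2 < 1) (hξη : (1 + ξ) * η ^ 2 < 1)
    (hf : ∀ i, Differentiable ℝ (f i)) (hS : Convex ℝ S) (hL : 0 < L)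
    (hlip : ∀ i, ∀ a ∈ S, ∀ b ∈ S, ‖∇ (f i) a - ∇ (f i) b‖ ≤ L * ‖a - b‖)
    {α : ℝ} (hα : 0 < α) (hαle : α ≤ stepSize N γ ξ η L)
    (hx : ∀ i, x i ∈ S) (hxd : ∀ i, (x + d) i ∈ S)
    (hmin : ∀ i, IsMinOn (localModel α (y i) (x i)) S ((x + d) i))
    (hy : avg y = avg fun i => ∇ (f i) (x i)) {xn yn : Fin N → Vec K}
    (hxn : xn = mix W (x + (1 / 2 : ℝ) • d))
    (hyn : yn = mix W y + fun i => ∇ (f i) (xn i) - ∇ (f i) (x i)) :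
    potential f γ ξ η L xn yn + stepDecrease α (1 - (1 + γ) * η ^ 2) x d ≤
      potential f γ ξ η L x y := by
  have xn_mem (i) : xn i ∈ S := by
    rw [hxn]
    exact mix_mem hW.doublyStochastic hS (fun j => hS.add_smul_mem (hx j) (hxd j)
      ⟨by norm_num, by norm_num⟩) i
  have consensus_x := hW.consensusError_half_step_le hγ hγη.le x d
  have consensus_y := hW.consensusError_tracking_le (y := y) hξ hlip hx (hxn ▸ xn_mem)
  rw [← hxn] at consensus_x consensus_y
  rw [← hyn] at consensus_y
  have step_coefficient := step_coefficient_le hN hγ hξ hγη hξη hL hα hαle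
  have margin_le_one : 1 - (1 + γ) * η ^ 2 ≤ 1 := sub_le_self _ (by positivity)
  unfold potential stepDecrease
  rw [← sub_pos] at hγη hξη
  rw [show (1 + γ) * η ^ 2 = 1 - (1 - (1 + γ) * η ^ 2) by ring] at consensus_x
  rw [show (1 + ξ) * η ^ 2 = 1 - (1 - (1 + ξ) * η ^ 2) by ring] at consensus_y
  set δ := 1 - (1 + γ) * η ^ 2
  set δ' := 1 - (1 + ξ) * η ^ 2
  set q := 1 + 1 / ξ
  set c := δ / (32 * q * L ^ 2) with hc
  have : 0 < q := by positivity
  set D := ∑ i, ‖d i‖ ^ 2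
  have function_value := avgFun_half_step_le hN hf hS hL hlip hα hx hxd hmin hy hγη hξη this
  rw [← avg_mix hW.doublyStochastic, ← hxn, ← hc,
    show 1 / (2 * (N * α)) = 2 * (1 / (4 * (N * α))) by ring] at function_value
  have gradient_weight : c * (q * L ^ 2) = δ / 32 := by
    simp only [hc]
    field_simp
  have weighted_consensus_y : c * consensusError yn ≤ c * consensusError y -
      c * δ' * consensusError y + δ / 32 * (8 * consensusError x + 1 / 2 * D) := by
    rw [← gradient_weight]
    refine (mul_le_mul_of_nonneg_left consensus_y (by positivity)).trans_eq ?_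
    ring
  have step_part := mul_le_mul_of_nonneg_right step_coefficient (show 0 ≤ D by positivity)
  have : δ * D ≤ 1 * D := by gcongr
  linarith

end Potential

section Lipschitz

variable {f : Fin N → Vec K → ℝ} {Lip : Fin N → Set (Vec K) → ℝ} {fmin : ℝ}

lemma le_maxLip (Lip : Fin N → Set (Vec K) → ℝ) (S : Set (Vec K)) (i : Fin N) :
    Lip i S ≤ maxLip Lip S :=
  le_ciSup (f := fun i => Lip i S) (Set.finite_range _).bddAbove i

lemma ProblemAssumption.maxLip_pos (hf : ProblemAssumption f Lip fmin) (hN : 0 < N)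
    {S : Set (Vec K)} (hS : IsCompact S) : 0 < maxLip Lip S :=
  (one_pos.trans_le (hf.one_le ⟨0, hN⟩ S hS)).trans_le (le_maxLip Lip S _)

lemma ProblemAssumption.stepSize_pos (hf : ProblemAssumption f Lip fmin) (hN : 0 < N) {γ ξ η : ℝ}
    (hγ : 0 < γ) (hξ : 0 < ξ) (hγη : (1 + γ) * η ^ 2 < 1) (hξη : (1 + ξ) * η ^ 2 < 1)
    {S : Set (Vec K)} (hS : IsCompact S) : 0 < stepSize N γ ξ η (maxLip Lip S) :=
  Magenta.stepSize_pos hN hγ hξ hγη hξη (hf.maxLip_pos hN hS)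

lemma ProblemAssumption.maxLip_mono (hf : ProblemAssumption f Lip fmin) (hN : 0 < N)
    {S₁ S₂ : Set (Vec K)} (h₁ : IsCompact S₁) (h₂ : IsCompact S₂) (h : S₁ ⊆ S₂) :
    maxLip Lip S₁ ≤ maxLip Lip S₂ :=
  have : Nonempty (Fin N) := ⟨⟨0, hN⟩⟩
  ciSup_le fun i => (hf.mono i _ _ h₁ h₂ h).trans (le_maxLip Lip _ i)

lemma ProblemAssumption.norm_gradient_sub_le (hf : ProblemAssumption f Lip fmin)
    {S : Set (Vec K)} (hS : IsCompact S) (i : Fin N) {a b : Vec K} (ha : a ∈ S) (hb : b ∈ S) :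
    ‖∇ (f i) a - ∇ (f i) b‖ ≤ maxLip Lip S * ‖a - b‖ :=
  (hf.lipschitz i S hS a ha b hb).trans (by gcongr; exact le_maxLip Lip S i)

end Lipschitz

section Run

variable {f : Fin N → Vec K → ℝ} {W : Matrix (Fin N) (Fin N) ℝ} {X : ℕ → Set (Vec K)}
  {α : ℕ → ℝ} {β : ℝ} {R : ℕ → ℕ} {x0 : Fin N → Vec K} {T : ℕ}
  {x xt y : ℕ → ℕ → Fin N → Vec K} {t r : ℕ}

lemma IsRun.x_succ (hrun : IsRun f W X α β R x0 T x xt y) (ht : t ≤ T) (hr : r < R t) :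
    x t (r + 1) = mix W (x t r + β • (xt t (r + 1) - x t r)) :=
  funext (hrun.step_x t ht r hr)

lemma IsRun.y_succ (hrun : IsRun f W X α β R x0 T x xt y) (ht : t ≤ T) (hr : r < R t) :
    y t (r + 1) = mix W (y t r) + fun i => ∇ (f i) (x t (r + 1) i) - ∇ (f i) (x t r i) :=
  funext fun i => (hrun.step_y t ht r hr i).trans (add_sub_assoc _ _ _)

lemma IsRun.x_next (hrun : IsRun f W X α β R x0 T x xt y) (ht : t < T) :
    x (t + 1) 0 = x t (R t) :=
  funext (hrun.next_x t ht)

lemma IsRun.y_next (hrun : IsRun f W X α β R x0 T x xt y) (ht : t < T) :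
    y (t + 1) 0 = y t (R t) :=
  funext (hrun.next_y t ht)

lemma IsRun.avg_x_succ (hrun : IsRun f W X α β R x0 T x xt y)
    (hW : W ∈ doublyStochastic ℝ (Fin N)) (ht : t ≤ T) (hr : r < R t) :
    avg (x t (r + 1)) - avg (x t r) = β • avg (xt t (r + 1) - x t r) := by
  rw [hrun.x_succ ht hr, avg_mix hW, avg_add, avg_smul, add_sub_cancel_left]

lemma IsRun.x_mem_of_xt_mem (hrun : IsRun f W X α β R x0 T x xt y)
    (hW : W ∈ doublyStochastic ℝ (Fin N)) (hβ : β ∈ Set.Icc 0 1) (ht : t ≤ T) {S : Set (Vec K)}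
    (hS : Convex ℝ S) (hstart : ∀ i, x t 0 i ∈ S)
    (hxt : ∀ r < R t, ∀ i, xt t (r + 1) i ∈ S) : ∀ r ≤ R t, ∀ i, x t r i ∈ S := by
  intro r
  induction r with
  | zero => exact fun _ => hstart
  | succ r ih =>
    intro hr
    rw [hrun.x_succ ht hr]
    exact mix_mem hW hS fun j => hS.add_smul_sub_mem (ih (Nat.le_of_succ_le hr) j) (hxt r hr j) hβ

lemma IsRun.x_mem (hrun : IsRun f W X α β R x0 T x xt y) (hW : W ∈ doublyStochastic ℝ (Fin N))
    (hβ : β ∈ Set.Icc 0 1) (hX : ∀ t, Convex ℝ (X t)) (hmono : Monotone X)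
    (hx0 : ∀ i, x0 i ∈ X 0) (ht : t ≤ T) (hr : r ≤ R t) (i : Fin N) : x t r i ∈ X t := by
  induction t generalizing r i with
  | zero =>
    exact hrun.x_mem_of_xt_mem hW hβ ht (hX 0) (fun i => hrun.init_x i ▸ hx0 i)
      (hrun.step_mem 0 ht) r hr i
  | succ t ih =>
    refine hrun.x_mem_of_xt_mem hW hβ ht (hX _) (fun i => ?_) (hrun.step_mem _ ht) r hr i
    rw [hrun.x_next ht]
    exact hmono t.le_succ (ih (Nat.le_of_succ_le ht) le_rfl i)

lemma IsRun.avg_y_succ (hrun : IsRun f W X α β R x0 T x xt y)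
    (hW : W ∈ doublyStochastic ℝ (Fin N)) (ht : t ≤ T) (hr : r < R t)
    (h : avg (y t r) = avg fun i => ∇ (f i) (x t r i)) :
    avg (y t (r + 1)) = avg fun i => ∇ (f i) (x t (r + 1) i) := by
  rw [hrun.y_succ ht hr, avg_add, avg_mix hW, h, ← avg_add]
  exact congrArg avg (funext fun i => add_sub_cancel _ _)

lemma IsRun.avg_y (hrun : IsRun f W X α β R x0 T x xt y) (hW : W ∈ doublyStochastic ℝ (Fin N))
    (ht : t ≤ T) (hr : r ≤ R t) : avg (y t r) = avg fun i => ∇ (f i) (x t r i) := by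
  induction t generalizing r with
  | zero =>
    induction r with
    | zero => exact congrArg avg (funext fun i => by rw [hrun.init_y, hrun.init_x])
    | succ r ih => exact hrun.avg_y_succ hW ht hr (ih (Nat.le_of_succ_le hr))
  | succ t ih_stage =>
    induction r with
    | zero =>
      rw [hrun.y_next ht, hrun.x_next ht]
      exact ih_stage (Nat.le_of_succ_le ht) le_rfl
    | succ r ih => exact hrun.avg_y_succ hW ht hr (ih (Nat.le_of_succ_le hr))

end Run

section TotalDecrease

variable {f : Fin N → Vec K → ℝ} {Lip : Fin N → Set (Vec K) → ℝ} {fmin : ℝ}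
  {W : Matrix (Fin N) (Fin N) ℝ} {η γ ξ : ℝ} {X : ℕ → Set (Vec K)} {α : ℕ → ℝ} {R : ℕ → ℕ}
  {x0 : Fin N → Vec K} {T : ℕ} {x xt y : ℕ → ℕ → Fin N → Vec K}
  (hrun : IsRun f W X α (1 / 2) R x0 T x xt y) (hW : IsAveragingMatrix W η) (hN : 0 < N)
  (hf : ProblemAssumption f Lip fmin) (hγ : 0 < γ) (hξ : 0 < ξ) (hγη : (1 + γ) * η ^ 2 < 1)
  (hξη : (1 + ξ) * η ^ 2 < 1) (hXc : ∀ t, IsCompact (X t)) (hXconv : ∀ t, Convex ℝ (X t))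
  (hXmono : Monotone X) (hx0 : ∀ i, x0 i ∈ X 0) (hα : ∀ t, 0 < α t)
  (hαle : ∀ t, α t ≤ stepSize N γ ξ η (maxLip Lip (X t)))

include hrun hW hN hf hγ hξ hγη hξη hXc hXconv hXmono hx0 hα hαle

lemma IsRun.potential_add_sum_stepDecrease_le {t r : ℕ} (ht : t ≤ T) (hr : r ≤ R t) :
    potential f γ ξ η (maxLip Lip (X t)) (x t r) (y t r) +
        ∑ s ∈ Finset.range r,
          stepDecrease (α t) (1 - (1 + γ) * η ^ 2) (x t s) (xt t (s + 1) - x t s) ≤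
      potential f γ ξ η (maxLip Lip (X t)) (x t 0) (y t 0) := by
  induction r with
  | zero => simp
  | succ r ih =>
    have step := hW.potential_add_stepDecrease_le (d := xt t (r + 1) - x t r) hN hγ hξ hγη hξη
      (fun i => (hf.contDiff i).differentiable one_ne_zero) (hXconv t) (hf.maxLip_pos hN (hXc t))
      (fun i a ha b hb => hf.norm_gradient_sub_le (hXc t) i ha hb) (hα t) (hαle t)
      (hrun.x_mem hW.doublyStochastic (by norm_num) hXconv hXmono hx0 ht (Nat.le_of_succ_le hr))
      (by simpa only [add_sub_cancel] using hrun.step_mem t ht r hr)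
      (by simpa only [add_sub_cancel] using hrun.step_min t ht r hr)
      (hrun.avg_y hW.doublyStochastic ht (Nat.le_of_succ_le hr)) (hrun.x_succ ht hr)
      (hrun.y_succ ht hr)
    rw [Finset.sum_range_succ]
    linarith [ih (Nat.le_of_succ_le hr)]

lemma IsRun.potential_start_add_sum_stepDecrease_le {n : ℕ} (hn : n + 1 ≤ T) :
    potential f γ ξ η (maxLip Lip (X (n + 1))) (x (n + 1) 0) (y (n + 1) 0) +
        ∑ t ∈ Finset.Icc 1 n, ∑ s ∈ Finset.range (R t),
          stepDecrease (α t) (1 - (1 + γ) * η ^ 2) (x t s) (xt t (s + 1) - x t s) ≤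
      potential f γ ξ η (maxLip Lip (X 1)) (x 1 0) (y 1 0) := by
  induction n with
  | zero => simp
  | succ n ih =>
    have stage := hrun.potential_add_sum_stepDecrease_le hW hN hf hγ hξ hγη hξη hXc hXconv hXmono
      hx0 hα hαle (Nat.le_of_succ_le hn) le_rfl
    have transition := potential_antitone (f := f) hξ hγη.le (hf.maxLip_pos hN (hXc (n + 1)))
      (hf.maxLip_mono hN (hXc _) (hXc _) (hXmono (n + 1).le_succ)) (x (n + 1 + 1) 0)
      (y (n + 1 + 1) 0)
    rw [Finset.sum_Icc_succ_top (Nat.le_add_left 1 n)]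
    rw [hrun.x_next hn, hrun.y_next hn] at transition ⊢
    linarith [ih (Nat.le_of_succ_le hn)]

lemma IsRun.exists_sum_stepDecrease_lt {c : ℕ → ℝ}
    (hc : potential f γ ξ η (maxLip Lip (X 1)) (x 1 0) (y 1 0) - fmin ≤
      ∑ t ∈ Finset.Icc 1 T, c t) :
    ∃ t ∈ Finset.Icc 1 T, ∑ s ∈ Finset.range (R t),
      stepDecrease (α t) (1 - (1 + γ) * η ^ 2) (x t s) (xt t (s + 1) - x t s) < c t := by
  have lower (t r) : fmin < potential f γ ξ η (maxLip Lip (X t)) (x t r) (y t r) :=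
    (hf.lower _).trans_le (avgFun_le_potential hξ hγη.le _ _ _)
  refine Finset.exists_lt_of_sum_lt (lt_of_lt_of_le ?_ hc)
  rcases T with _ | n
  · simpa using lower 1 0
  · have earlier_stages := hrun.potential_start_add_sum_stepDecrease_le hW hN hf hγ hξ hγη hξη hXc
      hXconv hXmono hx0 hα hαle le_rfl
    have last_stage := hrun.potential_add_sum_stepDecrease_le hW hN hf hγ hξ hγη hξη hXc hXconv
      hXmono hx0 hα hαle le_rfl le_rfl
    rw [Finset.sum_Icc_succ_top (Nat.le_add_left 1 n)]
    linarith [lower (n + 1) (R (n + 1))]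

end TotalDecrease

section Confinement

variable {α δ : ℝ}

lemma norm_sub_avg_sq_le_stepDecrease (hα : 0 ≤ α) (hδ : 0 < δ) (x d : Fin N → Vec K)
    (i : Fin N) : ‖x i - avg x‖ ^ 2 ≤ 2 / δ * stepDecrease α δ x d := by
  refine (norm_sub_avg_sq_le x i).trans ?_
  rw [stepDecrease, mul_add, ← mul_assoc (2 / δ) (δ / 2), div_mul_div_cancel₀ hδ.ne',
    div_self two_ne_zero, one_mul]
  exact le_add_of_nonneg_left (by positivity)

lemma sum_norm_sq_le_stepDecrease (hN : 0 < N) (hα : 0 < α) (hδ : 0 ≤ δ)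
    (x d : Fin N → Vec K) : ∑ i, ‖d i‖ ^ 2 ≤ 4 * (N * α) * stepDecrease α δ x d := by
  have := consensusError_nonneg x
  rw [stepDecrease, mul_add, ← mul_assoc (4 * (N * α)), mul_one_div_cancel (by positivity),
    one_mul]
  exact le_add_of_nonneg_right (by positivity)

variable {x d : ℕ → Fin N → Vec K} {r : ℕ}

lemma norm_avg_sub_avg_zero_sq_le (hN : 0 < N) (hα : 0 < α) (hδ : 0 ≤ δ)
    (havg : ∀ s < r, avg (x (s + 1)) - avg (x s) = (1 / 2 : ℝ) • avg (d s)) :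
    ‖avg (x r) - avg (x 0)‖ ^ 2 ≤
      r * α * ∑ s ∈ Finset.range r, stepDecrease α δ (x s) (d s) := by
  have step (s) (hs : s ∈ Finset.range r) :
      ‖avg (x (s + 1)) - avg (x s)‖ ^ 2 ≤ α * stepDecrease α δ (x s) (d s) :=
    calc ‖avg (x (s + 1)) - avg (x s)‖ ^ 2 = 1 / 4 * ‖avg (d s)‖ ^ 2 := by
          rw [havg s (Finset.mem_range.1 hs), norm_smul, mul_pow]
          norm_num
      _ ≤ 1 / 4 * (1 / N * (4 * (N * α) * stepDecrease α δ (x s) (d s))) := by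
          gcongr
          refine (norm_avg_sq_le _).trans ?_
          gcongr
          exact sum_norm_sq_le_stepDecrease hN hα hδ _ _
      _ = α * stepDecrease α δ (x s) (d s) := by field_simp
  rw [mul_assoc, Finset.mul_sum]
  exact (norm_sub_zero_sq_le_mul_sum (fun s => avg (x s)) r).trans
    (mul_le_mul_of_nonneg_left (Finset.sum_le_sum step) r.cast_nonneg)

lemma add_mem_ball_of_sum_stepDecrease_le (hN : 0 < N) {ε Δ v : ℝ} {R : ℕ} {z : Vec K}
    (hα : 0 < α) (hNα : N * α ≤ 1 / 10) (hε : 0 ≤ ε) (hεδ : ε < 2 * δ) (hδ : δ ≤ 1)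
    (hΔ : 0 < Δ) (hrα : r * (ε * α) ≤ 1) (hr : r < R) (hx0 : ∀ i, x 0 i ∈ Metric.closedBall z v)
    (havg : ∀ s < r, avg (x (s + 1)) - avg (x s) = (1 / 2 : ℝ) • avg (d s))
    (hdec : ∑ s ∈ Finset.range R, stepDecrease α δ (x s) (d s) ≤ ε / 128 * Δ ^ 2) (i : Fin N) :
    x r i + d r i ∈ Metric.ball z (v + Δ) := by
  have hδ0 : 0 < δ := by linarith
  have nonneg (s) : 0 ≤ stepDecrease α δ (x s) (d s) := stepDecrease_nonneg hα.le hδ0.le _ _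
  have dec_r : stepDecrease α δ (x r) (d r) ≤ ε / 128 * Δ ^ 2 :=
    (Finset.single_le_sum (fun s _ => nonneg s) (Finset.mem_range.2 hr)).trans hdec
  have dec_before_r : ∑ s ∈ Finset.range r, stepDecrease α δ (x s) (d s) ≤ ε / 128 * Δ ^ 2 :=
    (Finset.sum_le_sum_of_subset_of_nonneg (Finset.range_mono hr.le) fun s _ _ => nonneg s).trans
      hdec
  have lt_third {w : Vec K} (hw : ‖w‖ ^ 2 ≤ 1 / 32 * Δ ^ 2) : ‖w‖ < Δ / 3 :=
    lt_of_pow_lt_pow_left₀ 2 (by positivity) (by nlinarith [pow_pos hΔ 2])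
  have consensus : ‖x r i - avg (x r)‖ < Δ / 3 := lt_third <|
    calc ‖x r i - avg (x r)‖ ^ 2 ≤ 2 / δ * (ε / 128 * Δ ^ 2) :=
          (norm_sub_avg_sq_le_stepDecrease hα.le hδ0 _ _ i).trans (by gcongr)
      _ ≤ 2 / δ * (2 * δ / 128 * Δ ^ 2) := by gcongr
      _ = 1 / 32 * Δ ^ 2 := by field_simp; norm_num
  have step : ‖d r i‖ < Δ / 3 := lt_third <|
    calc ‖d r i‖ ^ 2 ≤ ∑ i, ‖d r i‖ ^ 2 :=
          Finset.single_le_sum (f := fun i => ‖d r i‖ ^ 2) (fun _ _ => by positivity)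
            (Finset.mem_univ i)
      _ ≤ 4 * (N * α) * (ε / 128 * Δ ^ 2) :=
          (sum_norm_sq_le_stepDecrease hN hα hδ0.le _ _).trans (by gcongr)
      _ ≤ 4 * (1 / 10) * (2 / 128 * Δ ^ 2) := by gcongr; linarith
      _ ≤ 1 / 32 * Δ ^ 2 := by nlinarith
  have drift : ‖avg (x r) - avg (x 0)‖ < Δ / 3 := lt_third <|
    calc ‖avg (x r) - avg (x 0)‖ ^ 2 ≤ r * α * (ε / 128 * Δ ^ 2) :=
          (norm_avg_sub_avg_zero_sq_le hN hα hδ0.le havg).trans (by gcongr)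
      _ = r * (ε * α) * (1 / 128 * Δ ^ 2) := by ring
      _ ≤ 1 * (1 / 32 * Δ ^ 2) := by gcongr; norm_num
      _ = 1 / 32 * Δ ^ 2 := one_mul _
  have start : ‖avg (x 0) - z‖ ≤ v :=
    mem_closedBall_iff_norm.1 (avg_mem hN (convex_closedBall z v) hx0)
  rw [mem_ball_iff_norm, show x r i + d r i - z =
    (x r i - avg (x r)) + d r i + (avg (x r) - avg (x 0)) + (avg (x 0) - z) by abel]
  linarith [norm_add₄_le (a := x r i - avg (x r)) (b := d r i) (c := avg (x r) - avg (x 0))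
    (d := avg (x 0) - z)]

lemma IsRun.xt_mem_ball_of_sum_stepDecrease_le {f : Fin N → Vec K → ℝ}
    {W : Matrix (Fin N) (Fin N) ℝ} {X : ℕ → Set (Vec K)} {α : ℕ → ℝ} {R : ℕ → ℕ}
    {x0 : Fin N → Vec K} {T : ℕ} {x xt y : ℕ → ℕ → Fin N → Vec K}
    (hrun : IsRun f W X α (1 / 2) R x0 T x xt y) (hW : W ∈ doublyStochastic ℝ (Fin N))
    (hN : 0 < N) {t : ℕ} (ht : t ≤ T) {ε v₀ v₁ : ℝ} {z : Vec K} (hα : 0 < α t)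
    (hNα : N * α t ≤ 1 / 10) (hε : 0 < ε) (hεδ : ε < 2 * δ) (hδ : δ ≤ 1)
    (hR : R t ≤ ⌈1 / (ε * α t)⌉₊) (hv : v₀ < v₁)
    (hstart : ∀ i, x t 0 i ∈ Metric.closedBall z v₀)
    (hdec : ∑ s ∈ Finset.range (R t), stepDecrease (α t) δ (x t s) (xt t (s + 1) - x t s) ≤
      ε / 128 * (v₁ - v₀) ^ 2) {r : ℕ} (hr : r < R t) (i : Fin N) :
    xt t (r + 1) i ∈ Metric.ball z v₁ := by
  have hrα : r * (ε * α t) ≤ 1 :=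
    (le_div_iff₀ (by positivity)).1 (Nat.lt_ceil.1 (hr.trans_le hR)).le
  simpa using add_mem_ball_of_sum_stepDecrease_le (d := fun s => xt t (s + 1) - x t s) hN hα hNα
    hε.le hεδ hδ (sub_pos.2 hv) hrα hr hstart
    (fun s hs => hrun.avg_x_succ hW ht (hs.trans hr)) hdec i

end Confinement

section Feasible

variable {v : ℕ → ℝ} {z : Vec K}

lemma isCompact_feasible (v : ℕ → ℝ) (z : Vec K) (t : ℕ) : IsCompact (feasible v z t) :=
  isCompact_closedBall z (v t)

lemma convex_feasible (v : ℕ → ℝ) (z : Vec K) (t : ℕ) : Convex ℝ (feasible v z t) :=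
  convex_closedBall z (v t)

lemma monotone_feasible (hv : Monotone v) (z : Vec K) : Monotone (feasible v z) :=
  fun _ _ h => Metric.closedBall_subset_closedBall (hv h)

lemma awayFromBoundary_feasible (hK : 0 < K) {t : ℕ} {u : Vec K}
    (hu : u ∈ Metric.ball z (v t)) : AwayFromBoundary (feasible v z t) u := by
  have hv : 0 < v t := Metric.pos_of_mem_ball hu
  have : Nonempty (Fin K) := ⟨⟨0, hK⟩⟩
  refine ⟨Metric.ball_subset_closedBall hu, ?_⟩
  rw [feasible, frontier_closedBall _ hv.ne', ← Metric.isClosed_sphere.notMem_iff_infDist_pos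
    (NormedSpace.sphere_nonempty.2 hv.le)]
  exact fun h => (Metric.mem_ball.1 hu).ne (Metric.mem_sphere.1 h)

end Feasible

lemma sum_sq_sub_pos {v : ℕ → ℝ} (hv : StrictMono v) {T : ℕ} (hT : 0 < T) :
    0 < ∑ t ∈ Finset.Icc 1 T, (v t - v (t - 1)) ^ 2 :=
  have growth (t) (ht : t ∈ Finset.Icc 1 T) : 0 < v t - v (t - 1) :=
    sub_pos.2 (hv (Nat.sub_one_lt_of_lt (Finset.mem_Icc.1 ht).1))
  Finset.sum_pos (fun t ht => pow_pos (growth t ht) 2) ⟨1, Finset.mem_Icc.2 ⟨le_rfl, hT⟩⟩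

lemma le_mul_of_natCast_eq_ceil {T : ℕ} (hT : 0 < T) {ε A V : ℝ} (hε : 0 < ε) (hV : 0 < V)
    (h : (T : ℤ) = ⌈1 / ε * (A / (1 / T * V))⌉) : A ≤ ε * V := by
  have le_T : 1 / ε * (A / (1 / T * V)) ≤ T := by exact_mod_cast Int.ceil_le.1 h.ge
  have quotient : 1 / ε * (A / (1 / T * V)) = T * (A / (ε * V)) := by field_simp
  rw [quotient, mul_le_iff_le_one_right (by positivity), div_le_one (by positivity)] at le_T
  exact le_T

end Magenta

theorem theorem2_general {N K : ℕ} (hN : 0 < N) (hK : 0 < K)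
    (f : Fin N → Magenta.Vec K → ℝ) (Lip : Fin N → Set (Magenta.Vec K) → ℝ) (fmin : ℝ)
    (hf : Magenta.ProblemAssumption f Lip fmin)
    (W : Matrix (Fin N) (Fin N) ℝ) (η : ℝ) (hW : Magenta.IsAveragingMatrix W η)
    (γ ξ : ℝ) (hγ : 0 < γ) (hξ : 0 < ξ)
    (hγη : (1 + γ) * η ^ 2 < 1) (hξη : (1 + ξ) * η ^ 2 < 1)
    (ε : ℝ) (hε : 0 < ε) (hεη : ε < 2 * (1 - (1 + γ) * η ^ 2))
    (x0 : Fin N → Magenta.Vec K) (v : ℕ → ℝ) (hv : StrictMono v) (z : Magenta.Vec K)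
    (X : ℕ → Set (Magenta.Vec K)) (hX : ∀ t, X t = Magenta.feasible v z t)
    (hx0 : ∀ i, x0 i ∈ X 0) (α : ℕ → ℝ) (hα : ∀ t, 0 < α t)
    (hαle : ∀ t, α t ≤ Magenta.stepSize N γ ξ η (Magenta.maxLip Lip (X t)))
    (R : ℕ → ℕ) (hR : ∀ t, 1 ≤ t → R t ≤ ⌈1 / (ε * α t)⌉₊)
    (T : ℕ) (x xt y : ℕ → ℕ → Fin N → Magenta.Vec K)
    (hrun : Magenta.IsRun f W X α (1 / 2) R x0 T x xt y)
    (hgap : 128 *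
        (Magenta.potential f γ ξ η (Magenta.maxLip Lip (X 1)) (x 1 0) (y 1 0) - fmin) ≤
      ε * ∑ t ∈ Finset.Icc 1 T, (v t - v (t - 1)) ^ 2) :
    ∃ t, 1 ≤ t ∧ t ≤ T ∧
      (∀ r ≤ R t, ∀ i, Magenta.AwayFromBoundary (X t) (x t r i)) ∧
      (∀ r, 1 ≤ r → r ≤ R t → ∀ i, Magenta.AwayFromBoundary (X t) (xt t r i)) ∧
      (∀ r < R t, ∀ i,
        IsMinOn (Magenta.localModel (α t) (y t r i) (x t r i)) Set.univ (xt t (r + 1) i) ∧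
        xt t (r + 1) i = x t r i - α t • y t r i) := by
  obtain rfl : X = Magenta.feasible v z := funext hX
  have hXc := Magenta.isCompact_feasible v z
  have hXconv := Magenta.convex_feasible v z
  have hXmono := Magenta.monotone_feasible hv.monotone z
  have half_mem : (1 / 2 : ℝ) ∈ Set.Icc 0 1 := by norm_num
  obtain ⟨t, ht, small_decrease⟩ := hrun.exists_sum_stepDecrease_lt hW hN hf hγ hξ hγη hξη hXc
    hXconv hXmono hx0 hα hαle (c := fun t => ε / 128 * (v t - v (t - 1)) ^ 2)
    (by rw [← Finset.mul_sum]; linarith)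
  obtain ⟨s, rfl⟩ := Nat.exists_eq_add_one.2 (Finset.mem_Icc.1 ht).1
  have htT := (Finset.mem_Icc.1 ht).2
  have hvs : v s < v (s + 1) := hv s.lt_succ_self
  have start (i) : x (s + 1) 0 i ∈ Metric.closedBall z (v s) := hrun.x_next htT ▸
    hrun.x_mem hW.doublyStochastic half_mem hXconv hXmono hx0 (Nat.le_of_succ_le htT) le_rfl i
  have xt_mem := fun r hr => hrun.xt_mem_ball_of_sum_stepDecrease_le hW.doublyStochastic hN htT
    (hα _) (Magenta.mul_le_tenth_of_le_stepSize hN hγ (hf.maxLip_pos hN (hXc _)) (hα _) (hαle _))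
    hε hεη (sub_le_self _ (by positivity)) (hR _ s.succ_pos) hvs start small_decrease.le (r := r) hr
  have x_mem := hrun.x_mem_of_xt_mem hW.doublyStochastic half_mem htT (convex_ball z _)
    (fun i => Metric.closedBall_subset_ball hvs (start i)) xt_mem
  refine ⟨s + 1, s.succ_pos, htT, fun r hr i => Magenta.awayFromBoundary_feasible hK (x_mem r hr i),
    fun r hr1 hr i => ?_, fun r hr i => ?_⟩
  · obtain ⟨q, rfl⟩ := Nat.exists_eq_add_one.2 hr1
    exact Magenta.awayFromBoundary_feasible hK (xt_mem q hr i)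
  · have unconstrained := Magenta.isMinOn_univ_of_mem_interior (hα _)
      (Metric.ball_subset_interior_closedBall (xt_mem r hr i)) (hrun.step_min _ htT r hr i)
    exact ⟨unconstrained, (Magenta.isMinOn_univ_localModel_iff (hα _)).1 unconstrained⟩

theorem theorem2 {N K : ℕ} (hN : 0 < N) (hK : 0 < K)
    (f : Fin N → Magenta.Vec K → ℝ) (Lip : Fin N → Set (Magenta.Vec K) → ℝ) (fmin : ℝ)
    (hf : Magenta.ProblemAssumption f Lip fmin)
    (G : SimpleGraph (Fin N)) (W : Matrix (Fin N) (Fin N) ℝ)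
    (hW : Magenta.IsMixingMatrix G W)
    (η : ℝ) (hη : η = Magenta.secondEigenvalue W)
    (γ ξ : ℝ) (hγ : 0 < γ) (hξ : 0 < ξ)
    (hγη : (1 + γ) * η ^ 2 < 1) (hξη : (1 + ξ) * η ^ 2 < 1)
    (ε : ℝ) (hε : 0 < ε) (hεη : ε < 2 * (1 - (1 + γ) * η ^ 2))
    -- the initial point, the radii and the feasible balls
    (x0 : Fin N → Magenta.Vec K) (v : ℕ → ℝ) (hv : StrictMono v)
    (X : ℕ → Set (Magenta.Vec K)) (hX : ∀ t, X t = Magenta.feasible v (Magenta.avg x0) t)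
    (hx0 : ∀ i, x0 i ∈ X 0)
    -- the stepsizes and the numbers of inner iterations (that of stage `0` is arbitrary)
    (α : ℕ → ℝ)
    (hα : ∀ t, α t = Magenta.stepSize N γ ξ η (Magenta.maxLip Lip (X t)))
    (R : ℕ → ℕ) (hR : ∀ t, 1 ≤ t → R t = ⌈1 / (ε * α t)⌉₊)
    -- the iterates of the stages `0, …, T`
    (T : ℕ) (hT : 0 < T) (x xt y : ℕ → ℕ → Fin N → Magenta.Vec K)
    (hrun : Magenta.IsRun f W X α (1 / 2) R x0 T x xt y)
    (hTstar : (T : ℤ) = ⌈1 / ε *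
      (128 * (Magenta.potential f γ ξ η (Magenta.maxLip Lip (X 1)) (x 1 0) (y 1 0) - fmin) /
        (1 / (T : ℝ) * ∑ t ∈ Finset.Icc 1 T, (v t - v (t - 1)) ^ 2))⌉) :
    ∃ t, 1 ≤ t ∧ t ≤ T ∧
      (∀ r ≤ R t, ∀ i, Magenta.AwayFromBoundary (X t) (x t r i)) ∧
      (∀ r, 1 ≤ r → r ≤ R t → ∀ i, Magenta.AwayFromBoundary (X t) (xt t r i)) ∧
      (∀ r < R t, ∀ i,
        IsMinOn (Magenta.localModel (α t) (y t r i) (x t r i)) Set.univ (xt t (r + 1) i) ∧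
        xt t (r + 1) i = x t r i - α t • y t r i) :=
  theorem2_general hN hK f Lip fmin hf W η (hη ▸ hW.isAveragingMatrix) γ ξ hγ hξ hγη hξη ε hε hεη
    x0 v hv _ X hX hx0 α
    (fun t => hα t ▸ hf.stepSize_pos hN hγ hξ hγη hξη (hX t ▸ Magenta.isCompact_feasible v _ t))
    (fun t => (hα t).le) R (fun t ht => (hR t ht).le) T x xt y hrun
    (Magenta.le_mul_of_natCast_eq_ceil hT hε (Magenta.sum_sq_sub_pos hv hT) hTstar)
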